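/- Let $S$ be a numerical monoid, that is, a submonoid of $(\mathbb N_0,+)$ with finite complement, and let $\mathcal A(S)=\{n_1,\ldots,n_t\}$ be its set of atoms (the non-zero elements of $S$ that are not a sum of two non-zero elements of $S$), where $t\ge 1$ and $1<n_1<\cdots<n_t$. Put $d=\gcd(n_2-n_1,\,n_3-n_2,\ldots,n_t-n_{t-1})$, and suppose that each of the two Diophantine equations $$(n_2-n_1)x_2+\cdots+(n_t-n_1)x_t=d\,n_1 \qquad\text{and}\qquad (n_t-n_1)y_1+\cdots+(n_t-n_{t-1})y_{t-1}=d\,n_t$$ has a solution in non-negative integers. For $a\in S$ let $\mathsf L(a)$ be the set of all $l\in\mathbb N_0$ such that $a$ is a sum of $l$ atoms; let $\rho(a)=\sup\{m/n : m,n\in\mathsf L(a)\}$ for $a\ne 0$, $\rho(0)=1$, and $\rho(S)=\sup\{\rho(a): a\in S\}$. Then there is an element $a^*\in S$ such that $\rho(a^*)=\rho(S)=n_t/n_1$ and $\mathsf L(a^*)$ is an arithmetical progression with difference $d$, that is, $\mathsf L(a^*)=\{m,\,m+d,\ldots,m+kd\}$ for some $m,k\in\mathbb N_0$. -/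

import Mathlib

open scoped ENNReal

namespace NumMon

/-- A numerical monoid: a submonoid of `(ℕ, +)` whose complement is finite. -/
def IsNumericalMonoid (S : AddSubmonoid ℕ) : Prop :=
  ((S : Set ℕ)ᶜ).Finite

/-- The set of atoms of a submonoid `S` of `(ℕ, +)`, viewed as a set of natural numbers.
Irreducibility is taken inside `S`. -/
def atoms (S : AddSubmonoid ℕ) : Set ℕ :=
  {m | ∃ u : S, AddIrreducible u ∧ (u : ℕ) = m}

/-- The factorization monoid of `S` (which is reduced): the free abelian monoid, written
additively, on the set of atoms of `S`. The length of `z` is `Multiset.card z`. -/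
abbrev Factorization (S : AddSubmonoid ℕ) : Type :=
  Multiset {u : S // AddIrreducible u}

/-- The factorization homomorphism: it sends a formal sum of atoms to its value in `S`. -/
def value (S : AddSubmonoid ℕ) (z : Factorization S) : S :=
  (z.map Subtype.val).sum

/-- The set of factorizations of `a`. -/
def factorizations (S : AddSubmonoid ℕ) (a : S) : Set (Factorization S) :=
  {z | value S z = a}

/-- The set of lengths of `a`. -/
def lengths (S : AddSubmonoid ℕ) (a : S) : Set ℕ :=
  {l | ∃ z ∈ factorizations S a, Multiset.card z = l}

open Classical in
/-- The elasticity of a set of lengths: the supremum of all quotients `m / n` with `m, n ∈ L`,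
and `1` if `L = {0}`. A set of lengths that contains `0` is equal to `{0}`, so no division by
zero takes part in the supremum. -/
noncomputable def setElasticity (L : Set ℕ) : ℝ≥0∞ :=
  if L = {0} then 1 else ⨆ m ∈ L, ⨆ n ∈ L, (m : ℝ≥0∞) / (n : ℝ≥0∞)

/-- The elasticity of an element of `S`. -/
noncomputable def elasticity (S : AddSubmonoid ℕ) (a : S) : ℝ≥0∞ :=
  setElasticity (lengths S a)

/-- The elasticity of `S`. -/
noncomputable def monoidElasticity (S : AddSubmonoid ℕ) : ℝ≥0∞ :=
  ⨆ a : S, elasticity S a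

/-- `L` is a (nonempty, finite) arithmetical progression with difference `d ≥ 1`:
`L = {m, m + d, …, m + k d}` for some `m` and `k`. -/
def IsArithProg (L : Set ℕ) (d : ℕ) : Prop :=
  0 < d ∧ ∃ m k : ℕ, L = {l | ∃ i ≤ k, l = m + i * d}

end NumMon

namespace NumMon

/-! Take a* = k·n_1·n_t with k large. Lengths of a* lie between k·n_1 and k·n_t, both attained,
which gives elasticity n_t/n_1. Every atom is ≡ n_1 mod d, and n_1 is prime to d, so all lengths
agree mod d (`modEq_of_sum_eq`). It remains to reach each length l = k·n_1 + j·d in that range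
(`exists_forall_exists_sum_eq`). Near the top, l copies of n_1 fall slightly short of a*, and the
x-equation repairs this; near the bottom, l copies of n_t overshoot, and the y-equation repairs
that. In between, Bézout coefficients reduced mod n_t - n_1 suffice. -/

theorem mem_lengths_iff {S : AddSubmonoid ℕ} {s : ℕ} {n : Fin s → ℕ}
    (hatoms : atoms S = Set.range n) (a : S) (l : ℕ) :
    l ∈ lengths S a ↔ ∃ c : Fin s → ℕ, ∑ i, c i * n i = a ∧ ∑ i, c i = l := by
  constructor
  · rintro ⟨z, hz, rfl⟩
    have hz' : value S z = a := hz
    subst hz'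
    clear hz
    induction z using Multiset.induction with
    | empty => exact ⟨0, by simp [value], by simp⟩
    | cons u z ih =>
      obtain ⟨c, hc, hl⟩ := ih
      have hu : (u.1 : ℕ) ∈ Set.range n := hatoms ▸ ⟨u.1, u.2, rfl⟩
      obtain ⟨i, hi⟩ := hu
      refine ⟨c + Pi.single i 1, ?_, ?_⟩
      · simp only [Pi.add_apply, add_mul, Finset.sum_add_distrib, hc, Pi.single_apply, ite_mul,
          one_mul, zero_mul, Finset.sum_ite_eq', Finset.mem_univ, if_true, hi]
        simp [value, add_comm]
      · simp [Finset.sum_add_distrib, hl]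
  · rintro ⟨c, hc, hl⟩
    have h : ∀ i, ∃ u : S, AddIrreducible u ∧ (u : ℕ) = n i := fun i => by
      have : n i ∈ atoms S := hatoms ▸ Set.mem_range_self i
      exact this
    choose u hu hun using h
    refine ⟨∑ i, c i • {(⟨u i, hu i⟩ : {u : S // AddIrreducible u})}, ?_, by simpa using hl⟩
    change value S _ = a
    apply Subtype.ext
    rw [← hc]
    simp only [value, ← Multiset.coe_mapAddMonoidHom, ← Multiset.coe_sumAddMonoidHom, map_sum,
      map_nsmul]
    simp [hun]

theorem dvd_of_forall_atoms_dvd {S : AddSubmonoid ℕ} {p : ℕ} (h : ∀ m ∈ atoms S, p ∣ m) :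
    ∀ a ∈ S, p ∣ a := by
  intro a
  induction a using Nat.strong_induction_on with
  | _ a ih =>
    intro ha
    by_cases h0 : a = 0
    · simp [h0]
    by_cases hirr : AddIrreducible (⟨a, ha⟩ : S)
    · exact h a ⟨_, hirr, rfl⟩
    have hunit : ∀ b : S, IsAddUnit b ↔ (b : ℕ) = 0 := fun b => by
      constructor
      · rintro ⟨v, rfl⟩
        have : ((v : S) : ℕ) + ((-v : AddUnits S) : S) = 0 := congrArg Subtype.val v.add_neg
        omega
      · intro hb
        have : b = 0 := Subtype.ext hb
        simp [this]
    rw [addIrreducible_iff] at hirr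
    simp only [hunit, h0, not_false_eq_true, true_and] at hirr
    push Not at hirr
    obtain ⟨b, c, hbc, hb, hc⟩ := hirr
    have hbc' : a = b + c := congrArg Subtype.val hbc
    rw [hbc']
    exact dvd_add (ih b (by omega) b.2) (ih c (by omega) c.2)

/-- The divisor also divides two consecutive large elements of `S`. -/
theorem IsNumericalMonoid.eq_one_of_forall_atoms_dvd {S : AddSubmonoid ℕ}
    (hS : IsNumericalMonoid S) {p : ℕ} (h : ∀ m ∈ atoms S, p ∣ m) : p = 1 := by
  obtain ⟨N, hN⟩ := hS.bddAbove
  have key : ∀ m, N < m → p ∣ m := fun m hm => by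
    refine dvd_of_forall_atoms_dvd h m ?_
    by_contra hmS
    exact absurd (hN hmS) (by omega)
  have := (Nat.dvd_add_right (key (N + 1) (by omega))).1 (key (N + 1 + 1) (by omega))
  exact Nat.dvd_one.1 this

theorem mul_le_mul_of_mem_lengths {S : AddSubmonoid ℕ} {s : ℕ} {n : Fin (s + 1) → ℕ}
    (hn : Monotone n) (hatoms : atoms S = Set.range n) {a : S} {l : ℕ} (hl : l ∈ lengths S a) :
    l * n 0 ≤ a ∧ (a : ℕ) ≤ l * n (Fin.last s) := by
  obtain ⟨c, hc, rfl⟩ := (mem_lengths_iff hatoms a l).1 hl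
  rw [← hc, Finset.sum_mul, Finset.sum_mul]
  exact ⟨Finset.sum_le_sum fun i _ => Nat.mul_le_mul_left _ (hn (Fin.zero_le i)),
    Finset.sum_le_sum fun i _ => Nat.mul_le_mul_left _ (hn (Fin.le_last i))⟩

theorem elasticity_le {S : AddSubmonoid ℕ} {s : ℕ} {n : Fin (s + 1) → ℕ}
    (hn : Monotone n) (hn0 : 0 < n 0) (hatoms : atoms S = Set.range n) (a : S) :
    elasticity S a ≤ (n (Fin.last s) : ℝ≥0∞) / (n 0 : ℝ≥0∞) := by
  have h0 : (n 0 : ℝ≥0∞) ≠ 0 := by exact_mod_cast hn0.ne'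
  unfold elasticity setElasticity
  split_ifs with h
  · rw [ENNReal.le_div_iff_mul_le (Or.inl h0) (Or.inl (ENNReal.natCast_ne_top _)), one_mul]
    exact_mod_cast hn (Fin.zero_le _)
  · refine iSup₂_le fun m hm => iSup₂_le fun k hk => ?_
    have h1 := (mul_le_mul_of_mem_lengths hn hatoms hm).1
    have h2 := (mul_le_mul_of_mem_lengths hn hatoms hk).2
    rw [ENNReal.le_div_iff_mul_le (Or.inl h0) (Or.inl (ENNReal.natCast_ne_top _))]
    -- Length `0` forces `a = 0`, hence `m = 0`, and `0 / 0 = 0` in `ℝ≥0∞`.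
    rcases Nat.eq_zero_or_pos k with rfl | hk0
    · have : m = 0 := by
        have : m * n 0 = 0 := by omega
        exact (Nat.mul_eq_zero.1 this).resolve_right hn0.ne'
      simp [this]
    · rw [mul_comm, ← mul_div_assoc]
      refine ENNReal.div_le_of_le_mul ?_
      have := h1.trans h2
      rw [mul_comm, mul_comm k] at this
      exact_mod_cast this

theorem elasticity_eq_of_mem_lengths {S : AddSubmonoid ℕ} {s : ℕ} {n : Fin (s + 1) → ℕ}
    (hn : Monotone n) (hn0 : 0 < n 0) (hatoms : atoms S = Set.range n) {a : S} {k : ℕ}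
    (hk : 0 < k) (hmax : k * n (Fin.last s) ∈ lengths S a) (hmin : k * n 0 ∈ lengths S a) :
    elasticity S a = (n (Fin.last s) : ℝ≥0∞) / (n 0 : ℝ≥0∞) := by
  refine le_antisymm (elasticity_le hn hn0 hatoms a) ?_
  unfold elasticity setElasticity
  rw [if_neg]
  · refine le_trans (le_of_eq ?_) (le_iSup₂_of_le _ hmax (le_iSup₂_of_le _ hmin le_rfl))
    push_cast
    rw [ENNReal.mul_div_mul_left _ _ (by exact_mod_cast hk.ne') (ENNReal.natCast_ne_top _)]
  · intro h
    rw [h] at hmin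
    exact (Nat.mul_pos hk hn0).ne' hmin

/-- Large multiples of the greatest common divisor of the `e i` are combinations of the `e i` in
which all coefficients but that of a chosen `D = e i₀` are bounded. -/
theorem exists_bounded_combination {ι : Type*} [Fintype ι] (e : ι → ℕ) {D d : ℕ} (hD : 0 < D)
    (heD : ∀ i, e i ≤ D) (hd : ∀ p : ℕ, (∀ i, p ∣ e i) → p ∣ d) (j : ℕ)
    (hj : Fintype.card ι * (D * D) ≤ d * j) :
    ∃ (b : ι → ℕ) (q : ℕ), ∑ i, b i * e i + q * D = d * j ∧ ∑ i, b i ≤ Fintype.card ι * D := by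
  obtain ⟨u, hu⟩ : ∃ u : ι → ℤ, ∑ i, u i * (e i : ℤ) = d := by
    rw [← Ideal.mem_span_range_iff_exists_fun (R := ℤ)]
    set I := Ideal.span (Set.range fun i => (e i : ℤ))
    obtain ⟨g, hg⟩ := (IsPrincipalIdealRing.principal I).principal
    have hg' : I = Ideal.span {g} := hg
    rw [hg', Ideal.mem_span_singleton, ← Int.natAbs_dvd_natAbs, Int.natAbs_natCast]
    refine hd _ fun i => ?_
    rw [← Int.natAbs_natCast (e i), Int.natAbs_dvd_natAbs, ← Ideal.mem_span_singleton, ← hg']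
    exact Ideal.subset_span ⟨i, rfl⟩
  have hDZ : (0 : ℤ) < D := by exact_mod_cast hD
  -- Reduce the Bézout coefficients of `d * j` mod `D`; the error is a multiple of `D`, absorbed by
  -- `q`, and `hj` keeps `q` non-negative.
  have hb : ∀ i, ∃ b : ℕ, b ≤ D ∧ (D : ℤ) ∣ u i * j - b := fun i => by
    refine ⟨((u i * j) % D).toNat, ?_, ?_⟩
    · have := Int.emod_lt_of_pos (u i * j) hDZ
      omega
    · rw [Int.toNat_of_nonneg (Int.emod_nonneg _ hDZ.ne')]
      exact Int.dvd_self_sub_emod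
  choose b hbD hbj using hb
  have hle : ∑ i, b i * e i ≤ d * j := by
    refine le_trans (Finset.sum_le_card_nsmul _ _ (D * D) fun i _ => ?_) (by simpa using hj)
    exact Nat.mul_le_mul (hbD i) (heD i)
  have hdvd : (D : ℤ) ∣ ((d * j - ∑ i, b i * e i : ℕ) : ℤ) := by
    rw [Nat.cast_sub hle]
    push_cast
    rw [← hu, Finset.sum_mul, ← Finset.sum_sub_distrib]
    refine Finset.dvd_sum fun i _ => ?_
    have : u i * (e i : ℤ) * j - b i * e i = (u i * j - b i) * e i := by ring
    rw [this]
    exact (hbj i).mul_right _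
  obtain ⟨q, hq⟩ := Int.natCast_dvd_natCast.1 hdvd
  refine ⟨b, q, ?_, ?_⟩
  · rw [mul_comm q, ← hq]; omega
  · simpa using Finset.sum_le_card_nsmul Finset.univ b D fun i _ => hbD i

/-- A combination of the gaps `n i - n 0` with at most `l` terms becomes a combination of the
`n i` with exactly `l` terms. -/
theorem exists_sum_eq_of_sum_sub_zero {s : ℕ} {n : Fin (s + 1) → ℕ} (hn : Monotone n)
    (b : Fin (s + 1) → ℕ) {l : ℕ} (hb : ∑ i, b i ≤ l) :
    ∃ c : Fin (s + 1) → ℕ, ∑ i, c i * n i = l * n 0 + ∑ i, b i * (n i - n 0) ∧ ∑ i, c i = l := by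
  refine ⟨b + Pi.single 0 (l - ∑ i, b i), ?_, ?_⟩
  · have h : ∀ i, b i * n i = b i * n 0 + b i * (n i - n 0) := fun i => by
      rw [← mul_add, Nat.add_sub_cancel' (hn (Fin.zero_le i))]
    simp only [Pi.add_apply, add_mul, Finset.sum_add_distrib, Pi.single_apply, ite_mul, zero_mul,
      Finset.sum_ite_eq', Finset.mem_univ, if_true, h, ← Finset.sum_mul]
    obtain ⟨r, rfl⟩ := Nat.exists_eq_add_of_le hb
    rw [Nat.add_sub_cancel_left]
    ring
  · simp [Finset.sum_add_distrib]
    omega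

theorem exists_sum_eq_of_sum_last_sub {s : ℕ} {n : Fin (s + 1) → ℕ} (hn : Monotone n)
    (b : Fin (s + 1) → ℕ) {l : ℕ} (hb : ∑ i, b i ≤ l) :
    ∃ c : Fin (s + 1) → ℕ,
      ∑ i, c i * n i + ∑ i, b i * (n (Fin.last s) - n i) = l * n (Fin.last s) ∧
        ∑ i, c i = l := by
  refine ⟨b + Pi.single (Fin.last s) (l - ∑ i, b i), ?_, ?_⟩
  · have h : ∀ i, b i * n (Fin.last s) = b i * n i + b i * (n (Fin.last s) - n i) := fun i => by
      rw [← mul_add, Nat.add_sub_cancel' (hn (Fin.le_last i))]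
    obtain ⟨r, rfl⟩ := Nat.exists_eq_add_of_le hb
    simp only [Pi.add_apply, add_mul, Finset.sum_add_distrib, Pi.single_apply, ite_mul, zero_mul,
      Finset.sum_ite_eq', Finset.mem_univ, if_true, Finset.sum_mul, h, Nat.add_sub_cancel_left]
    ring
  · simp [Finset.sum_add_distrib]
    omega

theorem dvd_sub_zero_of_dvd_succ_sub {s : ℕ} {n : Fin (s + 1) → ℕ} (hn : Monotone n) {d : ℕ}
    (h : ∀ i : Fin s, d ∣ n i.succ - n i.castSucc) (i : Fin (s + 1)) : d ∣ n i - n 0 := by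
  induction i using Fin.induction with
  | zero => simp
  | succ i ih =>
    have h1 := hn (Fin.zero_le i.castSucc)
    have h2 := hn (Fin.castSucc_lt_succ (i := i)).le
    have : n i.succ - n 0 = (n i.succ - n i.castSucc) + (n i.castSucc - n 0) := by omega
    rw [this]
    exact dvd_add (h i) ih

/-- For all large `k`, the number `k * n 0 * n (Fin.last s)` is a sum of exactly `k * n 0 + j * d`
of the `n i`, for every `j` compatible with the size constraints. -/
theorem exists_forall_exists_sum_eq {s : ℕ} {n : Fin (s + 1) → ℕ} (hn : Monotone n)
    (hn0 : 0 < n 0) {d g : ℕ} (hd0 : 0 < d) (hg0 : 0 < g) (hg : n (Fin.last s) - n 0 = d * g)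
    (hd : ∀ p : ℕ, (∀ i, p ∣ n i - n 0) → p ∣ d)
    (hx : ∃ x : Fin s → ℕ, ∑ i, (n i.succ - n 0) * x i = d * n 0)
    (hy : ∃ y : Fin s → ℕ,
      ∑ i, (n (Fin.last s) - n i.castSucc) * y i = d * n (Fin.last s)) :
    ∃ k, 0 < k ∧ ∀ j ≤ k * g, ∃ c : Fin (s + 1) → ℕ,
      ∑ i, c i * n i = k * n 0 * n (Fin.last s) ∧ ∑ i, c i = k * n 0 + j * d := by
  obtain ⟨x, hx⟩ := hx
  obtain ⟨y, hy⟩ := hy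
  have hlast : n (Fin.last s) = n 0 + d * g := by
    have := hn (Fin.zero_le (Fin.last s)); omega
  set D := d * g with hDdef
  have hD : 0 < D := Nat.mul_pos hd0 hg0
  set B := (s + 1) * D with hB
  set C := (s + 1) * (D * D) with hC
  -- Either extreme case then needs at most `k ≤ l` replaced atoms; the `+ 1` makes `k` positive.
  refine ⟨C * ∑ i, x i + D * B * ∑ i, y i + 1, by omega, fun j hj => ?_⟩
  set k := C * ∑ i, x i + D * B * ∑ i, y i + 1 with hk
  have hkl : k ≤ k * n 0 + j * d := (Nat.le_mul_of_pos_right k hn0).trans (Nat.le_add_right _ _)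
  obtain ⟨m, hm⟩ := Nat.exists_eq_add_of_le hj
  -- The shortfall of `l` copies of `n 0`, where `m = k * g - j` counts steps down from the maximal
  -- length.
  have htotal : (k * n 0 + j * d) * n 0 + d * (n 0 * m) = k * n 0 * n (Fin.last s) := by
    rw [hlast, hDdef]
    zify at hm ⊢
    linear_combination (-(d * n 0 : ℤ)) * hm
  -- Here `l` copies of the largest atom overshoot by `j * d * n (Fin.last s)`: use the `y`-solution
  -- `j` times.
  by_cases hjs : j < D * B
  · have hby : ∑ i, (Fin.snoc (fun i => j * y i) 0 : Fin (s + 1) → ℕ) i ≤ k * n 0 + j * d := by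
      rw [Fin.sum_univ_castSucc]
      simp only [Fin.snoc_castSucc, Fin.snoc_last, add_zero, ← Finset.mul_sum]
      have := Nat.mul_le_mul_right (∑ i, y i) hjs.le
      omega
    obtain ⟨c, hc, hcl⟩ := exists_sum_eq_of_sum_last_sub hn _ hby
    refine ⟨c, ?_, hcl⟩
    rw [Fin.sum_univ_castSucc (fun i => _ * (n (Fin.last s) - n i))] at hc
    simp only [Fin.snoc_castSucc, Fin.snoc_last, zero_mul, add_zero] at hc
    have : ∑ i : Fin s, j * y i * (n (Fin.last s) - n i.castSucc) = j * (d * n (Fin.last s)) := by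
      rw [← hy, Finset.mul_sum]
      exact Finset.sum_congr rfl fun i _ => by ring
    rw [this, add_mul, mul_assoc j] at hc
    omega
  -- The shortfall is `m` times the right side of the `x`-equation.
  by_cases hms : m < C
  · have hbx : ∑ i, (Fin.cons 0 (fun i => m * x i) : Fin (s + 1) → ℕ) i ≤ k * n 0 + j * d := by
      rw [Fin.sum_univ_succ]
      simp only [Fin.cons_succ, Fin.cons_zero, zero_add, ← Finset.mul_sum]
      have := Nat.mul_le_mul_right (∑ i, x i) hms.le
      omega
    obtain ⟨c, hc, hcl⟩ := exists_sum_eq_of_sum_sub_zero hn _ hbx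
    refine ⟨c, ?_, hcl⟩
    rw [hc, Fin.sum_univ_succ, ← htotal]
    simp only [Fin.cons_succ, Fin.cons_zero, zero_mul, zero_add]
    congr 1
    rw [← mul_assoc d, ← hx, Finset.sum_mul]
    exact Finset.sum_congr rfl fun i _ => by ring
  push Not at hjs hms
  obtain ⟨b, q, hbq, hbB⟩ := exists_bounded_combination (fun i => n i - n 0) hD
    (fun i => by have := hn (Fin.le_last i); omega) hd (n 0 * m) (by
      rw [Fintype.card_fin]
      exact hms.trans ((Nat.le_mul_of_pos_left _ hn0).trans (Nat.le_mul_of_pos_left _ hd0)))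
  rw [Fintype.card_fin] at hbB
  -- After multiplication by `D`, the term `j * d * n (Fin.last s)` leaves room for the `B` extra
  -- atoms, since `j ≥ D * B`.
  have hql : B + q ≤ k * n 0 + j * d := by
    have h1 : q * D ≤ d * (n 0 * m) := by omega
    have h2 : D * B ≤ j * d * n (Fin.last s) := by
      refine hjs.trans ((Nat.le_mul_of_pos_right _ hd0).trans (Nat.le_mul_of_pos_right _ ?_))
      omega
    have h3 : D * (k * n 0 + j * d) = d * (n 0 * m) + j * d * n (Fin.last s) := by
      rw [hlast, hDdef]
      zify at hm ⊢
      linear_combination (d * n 0 : ℤ) * hm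
    refine le_of_mul_le_mul_left (a := D) ?_ hD
    rw [h3, mul_add, mul_comm D q]
    omega
  have hbl : ∑ i, (b + Pi.single (Fin.last s) q : Fin (s + 1) → ℕ) i ≤ k * n 0 + j * d := by
    simp [Finset.sum_add_distrib]
    omega
  obtain ⟨c, hc, hcl⟩ := exists_sum_eq_of_sum_sub_zero hn _ hbl
  refine ⟨c, ?_, hcl⟩
  rw [hc, ← htotal, ← hbq]
  simp [add_mul, Finset.sum_add_distrib, Pi.single_apply, hg]

theorem modEq_of_sum_eq {ι : Type*} [Fintype ι] {n : ι → ℕ} {d r l : ℕ} (hr : r.Coprime d)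
    (hn : ∀ i, n i ≡ r [MOD d]) {c : ι → ℕ} {k : ℕ} (hc : ∑ i, c i * n i ≡ k * r [MOD d])
    (hl : ∑ i, c i = l) : l ≡ k [MOD d] := by
  have h : ∑ i, c i * n i ≡ ∑ i, c i * r [MOD d] := by
    simp only [← ZMod.natCast_eq_natCast_iff] at hn ⊢
    push_cast
    simp [hn]
  rw [← Finset.sum_mul, hl] at h
  exact Nat.ModEq.cancel_right_of_coprime hr.symm (h.symm.trans hc)

end NumMon

open NumMon in
/-- The atoms are `n 0 < n 1 < … < n s`, so that `t = s + 1`, `n_1 = n 0` and `n_t = n (Fin.last s)`.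
All natural-number differences below are of the form larger minus smaller. -/
theorem proposition6p5 (S : AddSubmonoid ℕ) (hS : NumMon.IsNumericalMonoid S)
    (s : ℕ) (n : Fin (s + 1) → ℕ) (hn : StrictMono n) (hn1 : 1 < n 0)
    (hatoms : NumMon.atoms S = Set.range n)
    (d : ℕ) (hd : d = Finset.univ.gcd (fun i : Fin s => n i.succ - n i.castSucc))
    (hx : ∃ x : Fin s → ℕ, ∑ i, (n i.succ - n 0) * x i = d * n 0)
    (hy : ∃ y : Fin s → ℕ,
      ∑ i, (n (Fin.last s) - n i.castSucc) * y i = d * n (Fin.last s)) :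
    ∃ a : S, NumMon.elasticity S a = NumMon.monoidElasticity S ∧
      NumMon.monoidElasticity S = (n (Fin.last s) : ℝ≥0∞) / (n 0 : ℝ≥0∞) ∧
      NumMon.IsArithProg (NumMon.lengths S a) d := by
  have hmono := hn.monotone
  have hn0 : 0 < n 0 := by omega
  have hdvd : ∀ i, d ∣ n i - n 0 :=
    dvd_sub_zero_of_dvd_succ_sub hmono fun i => hd ▸ Finset.gcd_dvd (Finset.mem_univ i)
  have hdgcd : ∀ p : ℕ, (∀ i, p ∣ n i - n 0) → p ∣ d := fun p hp => by
    rw [hd]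
    refine Finset.dvd_gcd fun i _ => ?_
    have h1 := hmono (Fin.zero_le i.castSucc)
    have : n i.succ - n i.castSucc = (n i.succ - n 0) - (n i.castSucc - n 0) := by omega
    rw [this]
    exact Nat.dvd_sub (hp _) (hp _)
  have hmod : ∀ i, n i ≡ n 0 [MOD d] := fun i =>
    ((Nat.modEq_iff_dvd' (hmono (Fin.zero_le i))).2 (hdvd i)).symm
  have hcop : (n 0).Coprime d := by
    refine hS.eq_one_of_forall_atoms_dvd fun m hm => ?_
    rw [hatoms] at hm
    obtain ⟨i, rfl⟩ := hm
    exact ((hmod i).dvd_iff (Nat.gcd_dvd_right _ _)).2 (Nat.gcd_dvd_left _ _)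
  have hd0 : 0 < d := by
    rcases Nat.eq_zero_or_pos d with h | h
    · rw [h, Nat.coprime_zero_right] at hcop
      omega
    · exact h
  obtain ⟨g, hg⟩ := hdvd (Fin.last s)
  -- For a single atom the gcd is empty, so `d = 0`.
  have hs : 0 < s := by
    rcases Nat.eq_zero_or_pos s with rfl | h
    · simp at hd
      omega
    · exact h
  have hlt : n 0 < n (Fin.last s) := hn (Fin.lt_def.2 (by simpa using hs))
  have hg0 : 0 < g := by
    rcases Nat.eq_zero_or_pos g with rfl | h
    · omega
    · exact h
  obtain ⟨k, hk, hsum⟩ := exists_forall_exists_sum_eq hmono hn0 hd0 hg0 hg hdgcd hx hy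
  have hlastS : n (Fin.last s) ∈ S := by
    have : n (Fin.last s) ∈ atoms S := hatoms ▸ Set.mem_range_self _
    obtain ⟨u, -, hu⟩ := this
    exact hu ▸ u.2
  let a : S := ⟨k * n 0 * n (Fin.last s), by simpa using S.nsmul_mem hlastS (k * n 0)⟩
  have hL : lengths S a = {l | ∃ i ≤ k * g, l = k * n 0 + i * d} := by
    ext l
    constructor
    · intro hl
      obtain ⟨h1, h2⟩ := mul_le_mul_of_mem_lengths hmono hatoms hl
      obtain ⟨c, hc, hcl⟩ := (mem_lengths_iff hatoms a l).1 hl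
      have hmin : k * n 0 ≤ l := Nat.le_of_mul_le_mul_right h2 (by omega)
      have hmax : l ≤ k * n (Fin.last s) := by
        refine Nat.le_of_mul_le_mul_right (h1.trans (le_of_eq ?_)) hn0
        change k * n 0 * n (Fin.last s) = _
        ring
      have hmodl : l ≡ k * n 0 [MOD d] :=
        modEq_of_sum_eq hcop hmod (hc ▸ (hmod (Fin.last s)).mul_left _) hcl
      obtain ⟨i, hi⟩ := (Nat.modEq_iff_dvd' hmin).1 hmodl.symm
      refine ⟨i, ?_, by rw [mul_comm i]; omega⟩
      refine le_of_mul_le_mul_left (a := d) ?_ hd0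
      have : k * n (Fin.last s) = k * n 0 + d * (k * g) := by
        rw [mul_left_comm, ← hg, ← mul_add, Nat.add_sub_cancel' hlt.le]
      omega
    · rintro ⟨i, hi, rfl⟩
      exact (mem_lengths_iff hatoms a _).2 (hsum i hi)
  have hel := elasticity_eq_of_mem_lengths hmono hn0 hatoms hk (a := a)
    (by
      rw [hL]
      refine ⟨k * g, le_rfl, ?_⟩
      rw [mul_assoc, mul_comm g, ← hg, ← mul_add, Nat.add_sub_cancel' hlt.le])
    (by rw [hL]; exact ⟨0, Nat.zero_le _, by simp⟩)
  have hmon : monoidElasticity S = (n (Fin.last s) : ℝ≥0∞) / (n 0 : ℝ≥0∞) :=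
    le_antisymm (iSup_le (elasticity_le hmono hn0 hatoms)) (hel ▸ le_iSup (elasticity S) a)
  exact ⟨a, hel.trans hmon.symm, hmon, hd0, _, _, hL⟩
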